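/- For integers $n\ge 1$ let $$P_n(z)=-\sum_{n/2\le r\le n-1}\frac{(n-r-1)!}{r!}\left(\frac z2\right)^{2r-n}+\sum_{\ell=0}^{\infty}(-1)^{\ell}\left(\frac z2\right)^{n+2\ell}\frac{\psi(n+\ell+1)-\psi(\ell+1)}{\ell!\,(n+\ell)!},$$ where $\psi=\Gamma'/\Gamma$ is the logarithmic derivative of the gamma function, and let $U_k$ denote the Chebyshev polynomial of the second kind, so that $U_k(\cos\theta)=\sin((k+1)\theta)/\sin\theta$. Then for every integer $n\ge 1$ and every real $x$ with $0<x<1$, the series $\sum_{m=1}^{\infty}P_{2n}(4\pi m)\cos(2\pi m x)$ converges (absolutely), and $$\sum_{m=1}^{\infty}P_{2n}(4\pi m)\cos(2\pi m x)=\frac1{2n}+\frac{(-1)^n}{2\pi}\left\{\arccos\left(\tfrac{x}{2}\right)U_{2n-1}\left(\tfrac{x}{2}\right)+\arccos\left(\tfrac{x+1}{2}\right)U_{2n-1}\left(\tfrac{x+1}{2}\right)+\arccos\left(\tfrac{1-x}{2}\right)U_{2n-1}\left(\tfrac{1-x}{2}\right)+\arccos\left(\tfrac{2-x}{2}\right)U_{2n-1}\left(\tfrac{2-x}{2}\right)\right\}.$$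 -/

import Mathlib

/-- The function `P_n` of Schläfli type (Watson's `T_n`):
`P_n(z) = -∑_{n/2 ≤ r ≤ n-1} (n-r-1)!/r! (z/2)^(2r-n)
  + ∑_{ℓ ≥ 0} (-1)^ℓ (z/2)^(n+2ℓ) (ψ(n+ℓ+1) - ψ(ℓ+1)) / (ℓ! (n+ℓ)!)`,
where `ψ` is the logarithmic derivative of the gamma function. -/
noncomputable def watsonP (n : ℕ) (z : ℂ) : ℂ :=
  -(∑ r ∈ (Finset.range n).filter (fun r => n ≤ 2 * r),
      ((n - r - 1).factorial : ℂ) / (r.factorial : ℂ) * (z / 2) ^ (2 * (r : ℤ) - (n : ℤ))) +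
  ∑' l : ℕ, (-1 : ℂ) ^ l * (z / 2) ^ (n + 2 * l) *
      (Complex.digamma ((n : ℂ) + (l : ℂ) + 1) - Complex.digamma ((l : ℂ) + 1)) /
        ((l.factorial : ℂ) * ((n + l).factorial : ℂ))

/-- The function `y ↦ arccos(y) U_{2n-1}(y)`, with `U_k` the Chebyshev polynomial of the
second kind. -/
noncomputable def arccosMulU (n : ℕ) (y : ℝ) : ℝ :=
  Real.arccos y * (Polynomial.Chebyshev.U ℝ (2 * (n : ℤ) - 1)).eval y

/-! The key is the representation `P_{2n}(z) = (4/π)(-1)^n ∫_0^{π/2} φ sin(2nφ) cos(z cos φ) dφ`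
(`watsonP_two_mul_eq`), obtained by expanding the outer cosine in powers of `z` and evaluating the
moments of `φ sin(2nφ)` against `cos^{2k} φ` (`sineMoment_eq`). With `t = cos φ` it becomes a cosine
transform of `arccos t · U_{2n-1}(t)` on `[0, 1]`. At `z = 4πm` the kernel has period `1/2` in `t`,
so folding at `1/2` and symmetrizing under `s ↦ 1 - s` gives the Fourier coefficients of a
continuous function on the circle whose value at `x` is the bracket with four terms.

The decay `O(z^{-4/3})` of the integral (`exists_bound_sineCosIntegral`) makes these coefficients
summable, so the Fourier series converges pointwise. Pairing `m` with `-m` gives the cosine series,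
and the zeroth coefficient accounts for `1/(2n)`. -/

theorem Complex.digamma_natCast_add_one (m : ℕ) :
    Complex.digamma ((m : ℂ) + 1) =
      ((harmonic m : ℝ) : ℂ) - (Real.eulerMascheroniConstant : ℂ) := by
  induction m with
  | zero => simp [Complex.digamma_one]
  | succ m ih =>
    rw [Complex.digamma_apply_add_one, Nat.cast_succ, ih, harmonic_succ]
    · push_cast; ring
    · intro k h
      have h' : ((m + 1 + k : ℕ) : ℂ) = 0 := by push_cast at h ⊢; rw [h]; ring
      exact absurd (Nat.cast_eq_zero.mp h') (by omega)

/-! ### Closed form of the trigonometric moments -/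

/-- The moment `∫ φ sin(2nφ) cos(φ)^(2k)` over `[0, π/2]`. -/
noncomputable def sineMoment (n k : ℕ) : ℝ :=
  ∫ φ in (0 : ℝ)..Real.pi / 2, φ * Real.sin (2 * n * φ) * Real.cos φ ^ (2 * k)

/-- The closed form of `sineMoment n k`, up to the factor `π / 4 * (2k)! / 4 ^ k`. -/
noncomputable def sineMomentCoeff (n k : ℕ) : ℝ :=
  if k < n then (-1) ^ (n + k + 1) * ((n - k - 1).factorial / (n + k).factorial)
  else ((harmonic (n + k) : ℝ) - (harmonic (k - n) : ℝ)) / ((k - n).factorial * (n + k).factorial)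

theorem sineMomentCoeff_add_left (k j : ℕ) :
    sineMomentCoeff (k + 1 + j) k = (-1) ^ j * (j.factorial / (2 * k + 1 + j).factorial) := by
  rw [sineMomentCoeff, if_pos (by omega), show k + 1 + j - k - 1 = j by omega,
    show k + 1 + j + k + 1 = 2 * (k + 1) + j by ring, pow_add, pow_mul,
    show k + 1 + j + k = 2 * k + 1 + j by ring]
  simp

theorem sineMomentCoeff_add_right (n j : ℕ) :
    sineMomentCoeff n (n + j) = ((harmonic (2 * n + j) : ℝ) - (harmonic j : ℝ)) /
      (j.factorial * (2 * n + j).factorial) := by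
  rw [sineMomentCoeff, if_neg (by omega), show n + j - n = j by omega,
    show n + (n + j) = 2 * n + j by ring]

/-- This mirrors `sineMoment_recurrence` after the normalization by `(2k)!/4^k`. The case split
follows which of the four entries lie on the factorial branch; `k = m` and `k = m + 1` mix the two
branches. -/
theorem sineMomentCoeff_recurrence (m k : ℕ) :
    (2 * k + 2) * (2 * k + 1) * sineMomentCoeff (m + 1) (k + 1) =
      2 * sineMomentCoeff (m + 1) k + sineMomentCoeff (m + 2) k + sineMomentCoeff m k := by
  have hf : ∀ j : ℕ, (j.factorial : ℝ) ≠ 0 := fun j => by positivity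
  rcases Nat.lt_trichotomy k m with h | rfl | h
  · obtain ⟨j, rfl⟩ : ∃ j, m = k + 1 + j := ⟨m - (k + 1), by omega⟩
    have e1 := sineMomentCoeff_add_left (k + 1) j
    have e2 := sineMomentCoeff_add_left k (j + 1)
    have e3 := sineMomentCoeff_add_left k (j + 2)
    have e4 := sineMomentCoeff_add_left k j
    rw [show k + 1 + 1 + j = k + 1 + j + 1 by ring,
      show 2 * (k + 1) + 1 + j = 2 * k + 1 + j + 2 by ring] at e1
    rw [show k + 1 + (j + 1) = k + 1 + j + 1 by ring,
      show 2 * k + 1 + (j + 1) = 2 * k + 1 + j + 1 by ring] at e2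
    rw [show k + 1 + (j + 2) = k + 1 + j + 2 by ring,
      show 2 * k + 1 + (j + 2) = 2 * k + 1 + j + 2 by ring] at e3
    rw [e1, e2, e3, e4]
    simp only [Nat.factorial_succ, Nat.cast_mul]
    have := hf (2 * k + 1 + j)
    have := hf j
    push_cast
    field_simp
    ring
  · have e1 := sineMomentCoeff_add_right (k + 1) 0
    have e2 := sineMomentCoeff_add_left k 0
    have e3 := sineMomentCoeff_add_left k 1
    have e4 := sineMomentCoeff_add_right k 0
    simp only [add_zero] at e1 e2 e4
    rw [e1, e2, show k + 2 = k + 1 + 1 by ring, e3, e4, show 2 * (k + 1) = 2 * k + 1 + 1 by ring]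
    simp only [harmonic_succ, Nat.factorial_succ, Nat.cast_mul, harmonic_zero]
    have := hf (2 * k)
    push_cast
    field_simp
    simp
    ring
  · obtain ⟨j, rfl⟩ : ∃ j, k = m + 1 + j := ⟨k - (m + 1), by omega⟩
    rcases j with _ | j
    · have e1 := sineMomentCoeff_add_right (m + 1) 1
      have e2 := sineMomentCoeff_add_right (m + 1) 0
      have e3 := sineMomentCoeff_add_left (m + 1) 0
      have e4 := sineMomentCoeff_add_right m 1
      simp only [add_zero] at e2 e3 ⊢
      rw [e1, e2, show m + 2 = m + 1 + 1 by ring, e3, e4,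
        show 2 * (m + 1) = 2 * m + 1 + 1 by ring]
      simp only [harmonic_succ, Nat.factorial_succ, Nat.cast_mul, harmonic_zero]
      have := hf (2 * m)
      push_cast
      field_simp
      simp
      ring
    · have e1 := sineMomentCoeff_add_right (m + 1) (j + 2)
      have e2 := sineMomentCoeff_add_right (m + 1) (j + 1)
      have e3 := sineMomentCoeff_add_right (m + 2) j
      have e4 := sineMomentCoeff_add_right m (j + 2)
      rw [show m + 1 + (j + 2) = m + 1 + (j + 1) + 1 by ring,
        show 2 * (m + 1) + (j + 2) = 2 * m + j + 1 + 1 + 1 + 1 by ring] at e1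
      rw [show 2 * (m + 1) + (j + 1) = 2 * m + j + 1 + 1 + 1 by ring] at e2
      rw [show m + 2 + j = m + 1 + (j + 1) by ring,
        show 2 * (m + 2) + j = 2 * m + j + 1 + 1 + 1 + 1 by ring] at e3
      rw [show m + (j + 2) = m + 1 + (j + 1) by ring,
        show 2 * m + (j + 2) = 2 * m + j + 1 + 1 by ring] at e4
      rw [e1, e2, e3, e4]
      simp only [harmonic_succ, Nat.factorial_succ, Nat.cast_mul]
      have := hf (2 * m + j)
      have := hf j
      push_cast
      generalize (harmonic (2 * m + j) : ℝ) = A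
      generalize (harmonic j : ℝ) = B
      field_simp
      ring

/-- Pointwise, `4 cos² φ = 2 + 2 cos 2φ`, and `2 cos 2φ` times `sin(2(m+1)φ)` splits into the two
neighbouring frequencies. With the values at `n = 0` and at `k = 0`, this determines every moment.
-/
theorem sineMoment_recurrence (m k : ℕ) :
    sineMoment (m + 1) (k + 1) =
      (2 * sineMoment (m + 1) k + sineMoment (m + 2) k + sineMoment m k) / 4 := by
  have hi : ∀ a b : ℕ, IntervalIntegrable
      (fun φ : ℝ => φ * Real.sin (2 * a * φ) * Real.cos φ ^ (2 * b)) MeasureTheory.volume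
      0 (Real.pi / 2) := fun a b => Continuous.intervalIntegrable (by fun_prop) _ _
  unfold sineMoment
  rw [← intervalIntegral.integral_const_mul,
    ← intervalIntegral.integral_add ((hi _ _).const_mul _) (hi _ _),
    ← intervalIntegral.integral_add (((hi _ _).const_mul _).add (hi _ _)) (hi _ _),
    ← intervalIntegral.integral_div]
  congr 1
  ext φ
  have h1 : Real.sin (2 * ((m + 2 : ℕ) : ℝ) * φ) + Real.sin (2 * m * φ) =
      2 * Real.sin (2 * ((m + 1 : ℕ) : ℝ) * φ) * (2 * Real.cos φ ^ 2 - 1) := by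
    rw [← Real.cos_two_mul,
      show 2 * ((m + 2 : ℕ) : ℝ) * φ = 2 * ((m + 1 : ℕ) : ℝ) * φ + 2 * φ by push_cast; ring,
      show 2 * (m : ℝ) * φ = 2 * ((m + 1 : ℕ) : ℝ) * φ - 2 * φ by push_cast; ring,
      Real.sin_add, Real.sin_sub]
    ring
  rw [show 2 * (k + 1) = 2 * k + 2 by ring, pow_add]
  linear_combination (-φ * Real.cos φ ^ (2 * k) / 4) * h1

theorem sineMoment_zero_right (m : ℕ) :
    sineMoment (m + 1) 0 = -(Real.pi / 4) * (-1) ^ (m + 1) / (m + 1) := by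
  have hm : (2 * ((m + 1 : ℕ) : ℝ)) ≠ 0 := by positivity
  have hd : ∀ φ : ℝ, HasDerivAt (fun φ : ℝ => -φ * Real.cos (2 * ((m + 1 : ℕ) : ℝ) * φ) /
      (2 * ((m + 1 : ℕ) : ℝ)) + Real.sin (2 * ((m + 1 : ℕ) : ℝ) * φ) /
      (2 * ((m + 1 : ℕ) : ℝ)) ^ 2) (φ * Real.sin (2 * ((m + 1 : ℕ) : ℝ) * φ)) φ := by
    intro φ
    have hl : HasDerivAt (fun φ : ℝ => 2 * ((m + 1 : ℕ) : ℝ) * φ) (2 * ((m + 1 : ℕ) : ℝ)) φ := by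
      simpa using (hasDerivAt_id φ).const_mul (2 * ((m + 1 : ℕ) : ℝ))
    refine ((((hasDerivAt_id φ).neg.mul hl.cos).div_const _).add
      (hl.sin.div_const _)).congr_deriv ?_
    simp only [Pi.neg_apply, id]
    field_simp
    ring
  unfold sineMoment
  simp only [mul_zero, pow_zero, mul_one]
  rw [intervalIntegral.integral_eq_sub_of_hasDerivAt (fun φ _ => hd φ)
    (Continuous.intervalIntegrable (by fun_prop) _ _),
    show 2 * ((m + 1 : ℕ) : ℝ) * (Real.pi / 2) = ((m + 1 : ℕ) : ℝ) * Real.pi by ring,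
    Real.cos_nat_mul_pi, Real.sin_nat_mul_pi]
  simp
  field_simp
  norm_num

theorem sineMoment_zero_left (k : ℕ) : sineMoment 0 k = 0 := by
  simp [sineMoment]

theorem sineMoment_eq (n k : ℕ) :
    sineMoment n k = Real.pi / 4 * ((2 * k).factorial / 4 ^ k) * sineMomentCoeff n k := by
  induction k generalizing n with
  | zero =>
    rcases n with _ | m
    · simp [sineMoment_zero_left, sineMomentCoeff]
    · rw [sineMoment_zero_right, sineMomentCoeff, if_pos (by omega)]
      have : (m.factorial : ℝ) ≠ 0 := by positivity
      simp [Nat.factorial_succ]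
      field_simp
      ring
  | succ k ih =>
    rcases n with _ | m
    · simp [sineMoment_zero_left, sineMomentCoeff]
    · rw [sineMoment_recurrence, ih, ih, ih, show 2 * (k + 1) = 2 * k + 1 + 1 by ring]
      simp only [Nat.factorial_succ]
      push_cast
      rw [pow_succ]
      field_simp
      linear_combination -sineMomentCoeff_recurrence m k

/-! ### Integral representation of `P_{2n}` -/

/-- The integral `∫ φ sin(2nφ) cos(z cos φ)` over `[0, π/2]`. -/
noncomputable def sineCosIntegral (n : ℕ) (z : ℝ) : ℝ :=
  ∫ φ in (0 : ℝ)..Real.pi / 2, φ * Real.sin (2 * n * φ) * Real.cos (z * Real.cos φ)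

theorem hasSum_sineCosIntegral (n : ℕ) (z : ℝ) :
    HasSum (fun k : ℕ => (-1) ^ k * z ^ (2 * k) / (2 * k).factorial * sineMoment n k)
      (sineCosIntegral n z) := by
  have hb := (Real.hasSum_cosh |z|).mul_left (Real.pi / 2)
  have hpi := Real.pi_pos
  have key : HasSum (fun k : ℕ => ∫ φ in (0 : ℝ)..Real.pi / 2, φ * Real.sin (2 * n * φ) *
      ((-1) ^ k * (z * Real.cos φ) ^ (2 * k) / (2 * k).factorial)) (sineCosIntegral n z) := by
    refine intervalIntegral.hasSum_integral_of_dominated_convergence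
      (fun k _ => Real.pi / 2 * (|z| ^ (2 * k) / (2 * k).factorial)) ?_ ?_ ?_ ?_ ?_
    · exact fun k => Continuous.aestronglyMeasurable (by fun_prop)
    · refine fun k => Filter.Eventually.of_forall fun φ hφ => ?_
      rw [Set.uIoc_of_le (by positivity)] at hφ
      rw [norm_mul, norm_mul, norm_div, norm_mul, norm_pow, norm_pow, norm_neg, norm_one, one_pow,
        one_mul, norm_mul, Real.norm_natCast]
      simp only [Real.norm_eq_abs]
      have h1 := Real.abs_sin_le_one (2 * n * φ)
      have h2 := Real.abs_cos_le_one φ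
      have h3 : |φ| ≤ Real.pi / 2 := by rw [abs_of_pos hφ.1]; exact hφ.2
      have h4 : |φ| * |Real.sin (2 * n * φ)| ≤ Real.pi / 2 * 1 := by gcongr
      have h5 : |z| * |Real.cos φ| ≤ |z| * 1 := by gcongr
      rw [mul_one] at h4 h5
      gcongr
    · exact Filter.Eventually.of_forall fun φ _ => hb.summable
    · exact intervalIntegrable_const
    · exact Filter.Eventually.of_forall fun φ _ => (Real.hasSum_cos _).mul_left _
  convert! key using 2 with k
  rw [sineMoment, ← intervalIntegral.integral_const_mul]
  congr 1
  ext φ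
  ring

theorem hasSum_sineMomentCoeff (n : ℕ) (z : ℝ) :
    HasSum (fun k : ℕ => (-1) ^ (n + k) * (z / 2) ^ (2 * k) * sineMomentCoeff n k)
      (4 / Real.pi * (-1) ^ n * sineCosIntegral n z) := by
  convert! (hasSum_sineCosIntegral n z).mul_left (4 / Real.pi * (-1) ^ n) using 2 with k
  have := Real.pi_ne_zero
  have hf : ((2 * k).factorial : ℝ) ≠ 0 := by positivity
  rw [sineMoment_eq, div_pow, pow_mul 2 2 k, pow_add]
  norm_num
  field_simp

theorem watsonP_two_mul_eq (n : ℕ) (z : ℝ) :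
    watsonP (2 * n) (z : ℂ) = ((4 / Real.pi * (-1) ^ n * sineCosIntegral n z : ℝ) : ℂ) := by
  have hs := Complex.hasSum_ofReal.mpr (hasSum_sineMomentCoeff n z)
  -- The terms `k < n` form the finite sum, with `r = n + k`; the tail `k = n + l` is the digamma
  -- series, where Euler's constant cancels in the difference.
  rw [← hs.tsum_eq, ← hs.summable.sum_add_tsum_nat_add n, watsonP, ← Finset.sum_neg_distrib]
  congr 1
  · symm
    refine Finset.sum_nbij' (fun k => n + k) (fun r => r - n) ?_ ?_ ?_ ?_ ?_
    · intro k hk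
      simp only [Finset.mem_range, Finset.mem_filter] at hk ⊢
      omega
    · intro r hr
      simp only [Finset.mem_range, Finset.mem_filter] at hr ⊢
      omega
    · intro k hk
      simp
    · intro r hr
      simp only [Finset.mem_range, Finset.mem_filter] at hr ⊢
      omega
    · intro k hk
      rw [Finset.mem_range] at hk
      rw [sineMomentCoeff, if_pos hk,
        show 2 * ((n + k : ℕ) : ℤ) - ((2 * n : ℕ) : ℤ) = ((2 * k : ℕ) : ℤ) by push_cast; ring,
        zpow_natCast, show 2 * n - (n + k) - 1 = n - k - 1 by omega]
      have h1 : ((-1 : ℂ) ^ (n + k)) * (-1) ^ (n + k) = 1 := by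
        rw [← mul_pow]; simp
      push_cast
      rw [pow_succ (-1 : ℂ) (n + k)]
      linear_combination (-((n - k - 1).factorial / (n + k).factorial : ℂ) *
        (z / 2 : ℂ) ^ (2 * k)) * h1
  · congr 1
    ext l
    rw [show ((2 * n : ℕ) : ℂ) + (l : ℂ) + 1 = ((2 * n + l : ℕ) : ℂ) + 1 by push_cast; ring,
      Complex.digamma_natCast_add_one, Complex.digamma_natCast_add_one, add_comm l n,
      sineMomentCoeff_add_right, show 2 * (n + l) = 2 * n + 2 * l by ring,
      show n + (n + l) = 2 * n + l by ring, pow_add (-1 : ℝ), pow_mul (-1 : ℝ)]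
    push_cast
    norm_num
    ring

/-! ### Decay of the oscillatory integral -/

/-- The phase `cos φ` is stationary at `0`, so the integral is cut at `ε = z^{-1/3}`: the piece near
`0` is bounded trivially, and integration by parts beyond `ε` costs `ε^{-2} z^{-1} = ε`. The
exponent `1/3` is not optimal, but any positive one suffices. -/
theorem exists_bound_integral_mul_sin_mul_cos {h : ℝ → ℝ} (hh : ContDiff ℝ 1 h) :
    ∃ C : ℝ, ∀ ε z : ℝ, 0 < ε → ε ≤ 1 → z * ε ^ 3 = 1 →
      |∫ φ in (0 : ℝ)..Real.pi / 2, h φ * Real.sin (z * Real.cos φ)| ≤ C * ε := by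
  have hc : Continuous h := hh.continuous
  have hc' : Continuous (deriv h) := hh.continuous_deriv le_rfl
  obtain ⟨A, hA⟩ := isCompact_Icc.exists_bound_of_continuousOn
    (s := Set.Icc 0 (Real.pi / 2)) hc.continuousOn
  obtain ⟨B, hB⟩ := isCompact_Icc.exists_bound_of_continuousOn
    (s := Set.Icc 0 (Real.pi / 2)) hc'.continuousOn
  have hpi := Real.pi_gt_three
  have hpi4 := Real.pi_le_four
  have hA0 : 0 ≤ A := (norm_nonneg _).trans (hA 0 ⟨le_rfl, by linarith⟩)
  have hB0 : 0 ≤ B := (norm_nonneg _).trans (hB 0 ⟨le_rfl, by linarith⟩)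
  -- `A` bounds the piece on `[0, ε]`, `4 * A` the two boundary terms, and `8 * (A + B)` the
  -- remaining integral, over a length at most `2`.
  refine ⟨A + 4 * A + 8 * (A + B), fun ε z hε hε1 hz => ?_⟩
  have hz0 : 0 < z := by
    by_contra hneg
    nlinarith [pow_pos hε 3]
  have hεpi : ε ≤ Real.pi / 2 := by linarith
  have hi : ∀ a b, IntervalIntegrable (fun φ => h φ * Real.sin (z * Real.cos φ))
      MeasureTheory.volume a b := fun a b => Continuous.intervalIntegrable (by fun_prop) _ _
  have hfirst : |∫ φ in (0 : ℝ)..ε, h φ * Real.sin (z * Real.cos φ)| ≤ A * ε := by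
    have := intervalIntegral.norm_integral_le_of_norm_le_const (a := 0) (b := ε) (C := A)
      (f := fun φ => h φ * Real.sin (z * Real.cos φ)) (fun φ hφ => by
        rw [Set.uIoc_of_le hε.le] at hφ
        rw [norm_mul]
        have h1 := hA φ ⟨hφ.1.le, hφ.2.trans hεpi⟩
        have h2 : ‖Real.sin (z * Real.cos φ)‖ ≤ 1 := Real.abs_sin_le_one _
        calc _ ≤ A * 1 := by gcongr
          _ = A := mul_one A)
    rwa [sub_zero, abs_of_pos hε] at this
  have hsin : ∀ φ ∈ Set.Icc ε (Real.pi / 2), ε / 2 ≤ Real.sin φ := by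
    intro φ hφ
    have h1 := Real.mul_le_sin (hε.le.trans hφ.1) hφ.2
    have h2 : 1 / 2 ≤ 2 / Real.pi := by
      rw [div_le_div_iff₀ (by norm_num) (by positivity)]; linarith
    have h3 : 1 / 2 * ε ≤ 2 / Real.pi * φ :=
      mul_le_mul h2 hφ.1 hε.le (by positivity)
    linarith
  have hsin0 : ∀ φ ∈ Set.Icc ε (Real.pi / 2), Real.sin φ ≠ 0 := fun φ hφ =>
    ((half_pos hε).trans_le (hsin φ hφ)).ne'
  have hv : ∀ φ, |Real.cos (z * Real.cos φ) * z⁻¹| ≤ z⁻¹ := fun φ => by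
    rw [abs_mul, abs_of_pos (inv_pos.mpr hz0)]
    exact mul_le_of_le_one_left (inv_pos.mpr hz0).le (Real.abs_cos_le_one _)
  have hu : ∀ φ ∈ Set.Icc ε (Real.pi / 2), |h φ / Real.sin φ| ≤ A / (ε / 2) := by
    intro φ hφ
    rw [abs_div]
    have h1 : |h φ| ≤ A := hA φ ⟨hε.le.trans hφ.1, hφ.2⟩
    have h2 := (hsin φ hφ).trans (le_abs_self _)
    gcongr
  have hparts : ∫ φ in ε..Real.pi / 2, h φ * Real.sin (z * Real.cos φ) =
      h (Real.pi / 2) / Real.sin (Real.pi / 2) * (Real.cos (z * Real.cos (Real.pi / 2)) * z⁻¹) -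
      h ε / Real.sin ε * (Real.cos (z * Real.cos ε) * z⁻¹) -
      ∫ φ in ε..Real.pi / 2, (deriv h φ * Real.sin φ - h φ * Real.cos φ) / Real.sin φ ^ 2 *
        (Real.cos (z * Real.cos φ) * z⁻¹) := by
    rw [← intervalIntegral.integral_mul_deriv_eq_deriv_mul (u := fun φ => h φ / Real.sin φ)
      (v := fun φ => Real.cos (z * Real.cos φ) * z⁻¹)
      (v' := fun φ => Real.sin φ * Real.sin (z * Real.cos φ))]
    · refine intervalIntegral.integral_congr fun φ hφ => ?_
      rw [Set.uIcc_of_le hεpi] at hφ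
      have := hsin0 φ hφ
      field_simp
    · intro φ hφ
      rw [Set.uIcc_of_le hεpi] at hφ
      exact (hh.differentiable one_ne_zero φ).hasDerivAt.div (Real.hasDerivAt_sin φ) (hsin0 φ hφ)
    · intro φ _
      refine (((Real.hasDerivAt_cos φ).const_mul z).cos.mul_const z⁻¹).congr_deriv ?_
      field_simp
    · refine ContinuousOn.intervalIntegrable ?_
      rw [Set.uIcc_of_le hεpi]
      exact ContinuousOn.div (by fun_prop) (by fun_prop) fun φ hφ => pow_ne_zero 2 (hsin0 φ hφ)
    · exact Continuous.intervalIntegrable (by fun_prop) _ _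
  have hrest : |∫ φ in ε..Real.pi / 2,
      (deriv h φ * Real.sin φ - h φ * Real.cos φ) / Real.sin φ ^ 2 *
        (Real.cos (z * Real.cos φ) * z⁻¹)| ≤ 2 * ((A + B) / (ε / 2) ^ 2 * z⁻¹) := by
    have := intervalIntegral.norm_integral_le_of_norm_le_const (a := ε) (b := Real.pi / 2)
      (C := (A + B) / (ε / 2) ^ 2 * z⁻¹)
      (f := fun φ => (deriv h φ * Real.sin φ - h φ * Real.cos φ) / Real.sin φ ^ 2 *
        (Real.cos (z * Real.cos φ) * z⁻¹)) (fun φ hφ => by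
        rw [Set.uIoc_of_le hεpi] at hφ
        have hφ' : φ ∈ Set.Icc ε (Real.pi / 2) := ⟨hφ.1.le, hφ.2⟩
        have hφ0 : φ ∈ Set.Icc 0 (Real.pi / 2) := ⟨hε.le.trans hφ'.1, hφ.2⟩
        rw [Real.norm_eq_abs, abs_mul, abs_div, abs_pow]
        have h1 : |h φ * Real.cos φ| ≤ A := by
          rw [abs_mul]
          calc _ ≤ A * 1 := mul_le_mul (hA φ hφ0) (Real.abs_cos_le_one φ) (abs_nonneg _) hA0
            _ = A := mul_one A
        have h2 : |deriv h φ * Real.sin φ| ≤ B := by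
          rw [abs_mul]
          calc _ ≤ B * 1 := mul_le_mul (hB φ hφ0) (Real.abs_sin_le_one φ) (abs_nonneg _) hB0
            _ = B := mul_one B
        have h3 : |deriv h φ * Real.sin φ - h φ * Real.cos φ| ≤ A + B :=
          (abs_sub _ _).trans (by linarith)
        have h4 := (hsin φ hφ').trans (le_abs_self _)
        have h5 := hv φ
        gcongr)
    refine this.trans ?_
    rw [abs_of_nonneg (by linarith), mul_comm]
    gcongr
    linarith
  have hεsq : ε ^ 2 ≤ ε := by nlinarith
  have hzi : z⁻¹ = ε ^ 3 := inv_eq_of_mul_eq_one_right hz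
  have hend : ∀ φ ∈ Set.Icc ε (Real.pi / 2),
      |h φ / Real.sin φ * (Real.cos (z * Real.cos φ) * z⁻¹)| ≤ 2 * A * ε := by
    intro φ hφ
    rw [abs_mul]
    calc _ ≤ A / (ε / 2) * z⁻¹ := mul_le_mul (hu φ hφ) (hv φ) (abs_nonneg _) (by positivity)
      _ = 2 * A * ε ^ 2 := by rw [hzi]; field_simp
      _ ≤ 2 * A * ε := by gcongr
  have hrest' : 2 * ((A + B) / (ε / 2) ^ 2 * z⁻¹) = 8 * (A + B) * ε := by
    rw [hzi]; field_simp; ring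
  rw [hrest'] at hrest
  have h1 := hend _ ⟨hεpi, le_rfl⟩
  have h2 := hend _ ⟨le_rfl, hεpi⟩
  rw [← intervalIntegral.integral_add_adjacent_intervals (hi 0 ε) (hi ε _), hparts]
  rw [abs_le] at hfirst hrest h1 h2 ⊢
  constructor <;> linarith [hfirst.1, hfirst.2, hrest.1, hrest.2, h1.1, h1.2, h2.1, h2.2]

/-- The factor `sin φ` allows one integration by parts that gains a full `z⁻¹`. Both boundary terms
vanish, at `0` by `hu0` and at `π/2` because `sin(z cos(π/2)) = 0`. -/
theorem exists_bound_integral_mul_sin_mul_cos_cos {u : ℝ → ℝ} (hu : ContDiff ℝ 2 u)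
    (hu0 : u 0 = 0) :
    ∃ C : ℝ, ∀ z : ℝ, 1 ≤ z →
      |∫ φ in (0 : ℝ)..Real.pi / 2, u φ * (Real.sin φ * Real.cos (z * Real.cos φ))| ≤
        C * z ^ (-(4 / 3) : ℝ) := by
  have hu' : ContDiff ℝ 1 (deriv u) := ((contDiff_succ_iff_deriv (n := 1)).mp hu).2.2
  obtain ⟨C, hC⟩ := exists_bound_integral_mul_sin_mul_cos hu'
  refine ⟨C, fun z hz => ?_⟩
  have hz0 : 0 < z := by linarith
  have hε := hC (z ^ (-(1 / 3) : ℝ)) z (by positivity)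
    (Real.rpow_le_one_of_one_le_of_nonpos hz (by norm_num)) (by
      rw [← Real.rpow_natCast, ← Real.rpow_mul hz0.le]
      norm_num
      rw [Real.rpow_neg_one, mul_inv_cancel₀ hz0.ne'])
  rw [intervalIntegral.integral_mul_deriv_eq_deriv_mul (u := u) (u' := deriv u)
    (v := fun φ => Real.sin (z * Real.cos φ) * -z⁻¹)]
  · simp only [Real.cos_pi_div_two, mul_zero, Real.sin_zero, zero_mul, hu0, sub_zero, zero_sub,
      abs_neg]
    rw [show (fun φ => deriv u φ * (Real.sin (z * Real.cos φ) * -z⁻¹)) =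
      fun φ => deriv u φ * Real.sin (z * Real.cos φ) * -z⁻¹ by ext; ring,
      intervalIntegral.integral_mul_const, abs_mul, abs_neg, abs_of_pos (inv_pos.mpr hz0)]
    refine (mul_le_mul_of_nonneg_right hε (inv_pos.mpr hz0).le).trans_eq ?_
    rw [← Real.rpow_neg_one, mul_assoc, ← Real.rpow_add hz0]
    norm_num
  · intro φ _
    exact (hu.differentiable two_ne_zero φ).hasDerivAt
  · intro φ _
    refine (((Real.hasDerivAt_cos φ).const_mul z).sin.mul_const (-z⁻¹)).congr_deriv ?_
    field_simp
  · exact hu'.continuous.intervalIntegrable _ _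
  · exact Continuous.intervalIntegrable (by fun_prop) _ _

theorem eval_U_cos_mul_sin (n : ℕ) (φ : ℝ) :
    (Polynomial.Chebyshev.U ℝ (2 * (n : ℤ) - 1)).eval (Real.cos φ) * Real.sin φ =
      Real.sin (2 * n * φ) := by
  rw [Polynomial.Chebyshev.U_real_cos]
  push_cast
  ring_nf

/-- Writing `sin(2nφ)` as `U_{2n-1}(cos φ) sin φ` supplies the factor `sin φ` and leaves the smooth
weight `φ U_{2n-1}(cos φ)`, which vanishes at `0`. -/
theorem exists_bound_sineCosIntegral (n : ℕ) :
    ∃ C : ℝ, ∀ z : ℝ, 1 ≤ z → |sineCosIntegral n z| ≤ C * z ^ (-(4 / 3) : ℝ) := by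
  have hp : ContDiff ℝ 2 fun φ : ℝ =>
      φ * (Polynomial.Chebyshev.U ℝ (2 * (n : ℤ) - 1)).eval (Real.cos φ) :=
    by
    have := (Polynomial.Chebyshev.U ℝ (2 * (n : ℤ) - 1)).contDiff_aeval (𝕜 := ℝ) 2
    simp only [Polynomial.coe_aeval_eq_eval] at this
    exact contDiff_id.mul (this.comp Real.contDiff_cos)
  obtain ⟨C, hC⟩ := exists_bound_integral_mul_sin_mul_cos_cos hp (by simp)
  refine ⟨C, fun z hz => ?_⟩
  convert! hC z hz using 2
  unfold sineCosIntegral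
  congr 1
  ext φ
  rw [← eval_U_cos_mul_sin]
  ring

/-! ### Folding and Fourier series on the circle -/

theorem continuous_arccosMulU (n : ℕ) : Continuous (arccosMulU n) :=
  Real.continuous_arccos.mul (Polynomial.continuous _)

theorem sineCosIntegral_eq_integral_arccosMulU (n : ℕ) (z : ℝ) :
    sineCosIntegral n z = ∫ t in (0 : ℝ)..1, Real.cos (z * t) * arccosMulU n t := by
  have hc := continuous_arccosMulU n
  have h := intervalIntegral.integral_comp_mul_deriv (a := Real.pi / 2) (b := 0)
    (fun φ _ => Real.hasDerivAt_cos φ) (by fun_prop)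
    (g := fun t => Real.cos (z * t) * arccosMulU n t) (by fun_prop)
  rw [Real.cos_pi_div_two, Real.cos_zero] at h
  rw [← h, intervalIntegral.integral_symm, ← intervalIntegral.integral_neg]
  refine intervalIntegral.integral_congr fun φ hφ => ?_
  rw [Set.uIcc_of_le (by positivity)] at hφ
  have h1 := eval_U_cos_mul_sin n φ
  simp only [Function.comp_apply, arccosMulU]
  rw [Real.arccos_cos hφ.1 (hφ.2.trans (by linarith [Real.pi_pos])), ← h1]
  ring

theorem sineCosIntegral_neg (n : ℕ) (z : ℝ) : sineCosIntegral n (-z) = sineCosIntegral n z := by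
  simp [sineCosIntegral]

theorem sineCosIntegral_zero {n : ℕ} (hn : 1 ≤ n) :
    sineCosIntegral n 0 = -(Real.pi / 4) * (-1) ^ n / n := by
  obtain ⟨m, rfl⟩ : ∃ m, n = m + 1 := ⟨n - 1, by omega⟩
  have h := sineMoment_zero_right m
  simp only [sineMoment, mul_zero, pow_zero, mul_one] at h
  simp only [sineCosIntegral, zero_mul, Real.cos_zero, mul_one]
  rw [h]
  push_cast
  rfl

/-- The substitution `s ↦ 1 - s` conjugates the character, so the two halves combine into a cosine.
-/
theorem integral_exp_mul_add_reflect {G : ℝ → ℝ} (hG : Continuous G) (m : ℤ) :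
    ∫ s in (0 : ℝ)..1, Complex.exp (2 * Real.pi * Complex.I * (-m : ℤ) * s) *
        ((G s + G (1 - s) : ℝ) : ℂ) =
      ((2 * ∫ s in (0 : ℝ)..1, Real.cos (2 * Real.pi * m * s) * G s : ℝ) : ℂ) := by
  have hr : ∫ s in (0 : ℝ)..1, Complex.exp (2 * Real.pi * Complex.I * (-m : ℤ) * s) *
        ((G (1 - s) : ℝ) : ℂ) =
      ∫ s in (0 : ℝ)..1, Complex.exp (2 * Real.pi * Complex.I * m * s) * (G s : ℂ) := by
    have h := intervalIntegral.integral_comp_sub_left (a := 0) (b := 1)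
      (fun s : ℝ => Complex.exp (2 * Real.pi * Complex.I * m * s) * (G s : ℂ)) 1
    rw [sub_zero, sub_self] at h
    rw [← h]
    congr 1
    ext s
    rw [show 2 * Real.pi * Complex.I * m * ((1 - s : ℝ) : ℂ) =
      2 * Real.pi * Complex.I * (-m : ℤ) * s + m * (2 * Real.pi * Complex.I) by push_cast; ring,
      Complex.exp_add, Complex.exp_int_mul_two_pi_mul_I, mul_one]
  simp only [Complex.ofReal_add, mul_add]
  rw [intervalIntegral.integral_add (Continuous.intervalIntegrable (by fun_prop) _ _)
    (Continuous.intervalIntegrable (by fun_prop) _ _), hr,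
    ← intervalIntegral.integral_add (Continuous.intervalIntegrable (by fun_prop) _ _)
    (Continuous.intervalIntegrable (by fun_prop) _ _), Complex.ofReal_mul,
    ← intervalIntegral.integral_ofReal, ← intervalIntegral.integral_const_mul]
  congr 1
  ext s
  push_cast
  rw [Complex.cos]
  ring_nf

/-- The sum of `arccosMulU n` over the two preimages of `s` under doubling modulo one. -/
noncomputable def arccosMulUFold (n : ℕ) (s : ℝ) : ℝ :=
  arccosMulU n (s / 2) + arccosMulU n ((s + 1) / 2)

theorem continuous_arccosMulUFold (n : ℕ) : Continuous (arccosMulUFold n) := by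
  have := continuous_arccosMulU n
  unfold arccosMulUFold
  fun_prop

/-- Split `[0, 1]` at `1/2` and rescale each half: `cos(4πmt)` is unchanged by `t ↦ t + 1/2`. -/
theorem integral_cos_mul_arccosMulUFold (n : ℕ) (m : ℤ) :
    ∫ s in (0 : ℝ)..1, Real.cos (2 * Real.pi * m * s) * arccosMulUFold n s =
      2 * sineCosIntegral n (4 * Real.pi * m) := by
  have hc := continuous_arccosMulU n
  rw [sineCosIntegral_eq_integral_arccosMulU]
  set F : ℝ → ℝ := fun t => Real.cos (4 * Real.pi * m * t) * arccosMulU n t with hF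
  have hFc : Continuous F := by fun_prop
  have h1 := intervalIntegral.integral_comp_div (a := 0) (b := 1) F two_ne_zero
  have h2 := intervalIntegral.integral_comp_div_add (a := 0) (b := 1) F two_ne_zero (1 / 2)
  rw [zero_div] at h1
  rw [zero_div, zero_add, show (1 : ℝ) / 2 + 1 / 2 = 1 by norm_num] at h2
  simp only [smul_eq_mul] at h1 h2
  rw [← intervalIntegral.integral_add_adjacent_intervals (b := 1 / 2)
    (hFc.intervalIntegrable _ _) (hFc.intervalIntegrable _ _), mul_add, ← h1, ← h2,
    ← intervalIntegral.integral_add (Continuous.intervalIntegrable (by fun_prop) _ _)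
      (Continuous.intervalIntegrable (by fun_prop) _ _)]
  congr 1
  ext s
  simp only [hF, arccosMulUFold]
  rw [show 4 * Real.pi * m * (s / 2) = 2 * Real.pi * m * s by ring,
    show 4 * Real.pi * m * (s / 2 + 1 / 2) = 2 * Real.pi * m * s + m * (2 * Real.pi) by ring,
    Real.cos_add_int_mul_two_pi, add_div]
  ring

theorem summable_sineCosIntegral_nat (n : ℕ) :
    Summable fun m : ℕ => sineCosIntegral n (4 * Real.pi * m) := by
  obtain ⟨C, hC⟩ := exists_bound_sineCosIntegral n
  have hs : Summable fun m : ℕ => C * (4 * Real.pi) ^ (-(4 / 3) : ℝ) * (m : ℝ) ^ (-(4 / 3) : ℝ) :=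
    (Real.summable_nat_rpow.mpr (by norm_num)).mul_left _
  refine Summable.of_norm_bounded_eventually_nat hs ?_
  filter_upwards [Filter.eventually_ge_atTop 1] with m hm
  have hm' : (1 : ℝ) ≤ m := by exact_mod_cast hm
  have hpi := Real.pi_gt_three
  rw [mul_assoc C, ← Real.mul_rpow (by positivity) (by positivity)]
  exact hC _ (by nlinarith)

theorem summable_sineCosIntegral_int (n : ℕ) :
    Summable fun m : ℤ => sineCosIntegral n (4 * Real.pi * m) := by
  refine Summable.of_nat_of_neg ?_ ?_
  · simpa using summable_sineCosIntegral_nat n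
  · simpa [sineCosIntegral_neg] using summable_sineCosIntegral_nat n

theorem hasSum_sineCosIntegral_int (n : ℕ) {x : ℝ} (hx : x ∈ Set.Ico (0 : ℝ) 1) :
    HasSum (fun m : ℤ => ((4 * sineCosIntegral n (4 * Real.pi * m) : ℝ) : ℂ) *
        Complex.exp (2 * Real.pi * Complex.I * m * x))
      ((arccosMulUFold n x + arccosMulUFold n (1 - x) : ℝ) : ℂ) := by
  have hG := continuous_arccosMulUFold n
  set g : ℝ → ℂ := fun s => ((arccosMulUFold n s + arccosMulUFold n (1 - s) : ℝ) : ℂ) with hg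
  have hgc : Continuous g := by fun_prop
  -- Symmetry under `s ↦ 1 - s` gives `g 0 = g 1`, hence continuity on the circle.
  let B : C(AddCircle (1 : ℝ), ℂ) := ⟨AddCircle.liftIco 1 0 g,
    AddCircle.liftIco_zero_continuous (by simp [hg, add_comm]) hgc.continuousOn⟩
  have hB : ∀ m : ℤ, fourierCoeff B m = ((4 * sineCosIntegral n (4 * Real.pi * m) : ℝ) : ℂ) := by
    intro m
    change fourierCoeff (AddCircle.liftIco 1 0 g) m = _
    rw [fourierCoeff_liftIco_eq, fourierCoeffOn_eq_integral]
    simp only [zero_add, sub_zero, div_one, one_smul, smul_eq_mul, fourier_coe_apply,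
      Complex.ofReal_one, hg]
    rw [integral_exp_mul_add_reflect hG, integral_cos_mul_arccosMulUFold]
    norm_num [← mul_assoc]
  have hsum : Summable (fourierCoeff B) := by
    simp only [funext hB]
    exact Complex.summable_ofReal.mpr ((summable_sineCosIntegral_int n).mul_left 4)
  have h := has_pointwise_sum_fourier_series_of_summable hsum (x : AddCircle (1 : ℝ))
  have hv : B (x : AddCircle (1 : ℝ)) = g x := by
    change AddCircle.liftIco 1 0 g x = g x
    exact AddCircle.liftIco_coe_apply (show x ∈ Set.Ico 0 (0 + 1) by rwa [zero_add])
  rw [hv] at h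
  simpa only [hB, smul_eq_mul, fourier_coe_apply, Complex.ofReal_one, div_one] using h

theorem mainTheorem6 (n : ℕ) (hn : 1 ≤ n) (x : ℝ) (hx0 : 0 < x) (hx1 : x < 1) :
    HasSum
      (fun m : ℕ => watsonP (2 * n) (4 * (Real.pi : ℂ) * ((m : ℂ) + 1)) *
        ((Real.cos (2 * Real.pi * ((m : ℝ) + 1) * x) : ℝ) : ℂ))
      ((1 / (2 * (n : ℝ)) + (-1 : ℝ) ^ n / (2 * Real.pi) *
        (arccosMulU n (x / 2) + arccosMulU n ((x + 1) / 2) +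
          arccosMulU n ((1 - x) / 2) + arccosMulU n ((2 - x) / 2)) : ℝ) : ℂ) := by
  -- Pairing `m` with `-m` counts the term at `0` twice; removing the first pair leaves the full sum
  -- minus one zeroth term, which after scaling is `-1/(2n)`.
  have h := (hasSum_nat_add_iff' 1).mpr
    (hasSum_sineCosIntegral_int n (x := x) ⟨hx0.le, hx1⟩).nat_add_neg
  have h' := h.mul_left (((-1) ^ n / (2 * Real.pi) : ℝ) : ℂ)
  have hpi : (Real.pi : ℂ) ≠ 0 := by exact_mod_cast Real.pi_ne_zero
  convert! h' using 1
  · ext m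
    rw [show 4 * (Real.pi : ℂ) * ((m : ℂ) + 1) = ((4 * Real.pi * (m + 1) : ℝ) : ℂ) by push_cast; ring,
      watsonP_two_mul_eq]
    push_cast
    rw [show 4 * Real.pi * -((m : ℝ) + 1) = -(4 * Real.pi * (m + 1)) by ring,
      sineCosIntegral_neg, Complex.cos]
    field_simp
  · have hn' : (n : ℂ) ≠ 0 := by exact_mod_cast (by omega : n ≠ 0)
    have hs : ((-1 : ℂ) ^ n) * (-1) ^ n = 1 := by rw [← mul_pow]; simp
    simp only [Finset.range_one, Finset.sum_singleton, Nat.cast_zero, Int.cast_zero, mul_zero,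
      neg_zero, sineCosIntegral_zero hn, zero_mul, Complex.exp_zero, mul_one, arccosMulUFold]
    rw [show 1 - x + 1 = 2 - x by ring]
    push_cast
    field_simp
    linear_combination -(Real.pi : ℂ) * hs
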